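/- Let $N\ge 2$, let $K=SU(N)$ with maximal torus $T$ of diagonal matrices, and let $LK$ be the free loop group (loops $S^1\to K$, pointwise multiplication). For $p\ne q$ and $k\in\mathbb Z$ let $K_{(e_p-e_q,k)}\subset LK$ be the subgroup generated by the constant loops in $T$ and by all loops $z\mapsto\begin{pmatrix} a&-\bar b z^k\\ bz^{-k}&\bar a\end{pmatrix}$, $|a|^2+|b|^2=1$, placed in the $(p,q)$-block (and equal to the identity elsewhere). Put $K_{(i)}=K_{(e_i-e_{i+1},0)}$ for $1\le i\le N-1$ and $K_{(0)}=K_{(e_N-e_1,1)}$. Let $\dot s_i\in K_{(i)}$ be the loop with $a=0$, $b=1$; for $i\ge1$ this is the canonical lift $\exp(F_{\alpha_i})\exp(-E_{\alpha_i})\exp(F_{\alpha_i})$ of the simple reflection $s_i$. For a word $w=s_{i_1}\cdots s_{i_n}$ ($n\ge 0$) in the simple reflections $s_0,\dots,s_{N-1}$ of the affine Weyl group $S_N\ltimes Q$ ($Q$ the coroot lattice, $s_0=r_\theta t^{-\theta^\vee}$ with $\theta$ the highest root), the Bott–Samelson manifold is $M_w=(K_{(i_1)}\times\cdots\times K_{(i_n)})/T^n$,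 where $T^n$ acts by $(x_1,\dots,x_n)\cdot(t_1,\dots,t_n)=(x_1t_1,\,t_1^{-1}x_2t_2,\dots,t_{n-1}^{-1}x_nt_n)$. The group $T\times S^1$ acts on $M_w$ by $t\cdot[k_1,\dots,k_n]=[tk_1,k_2,\dots,k_n]$ and $\theta\cdot[k_1,\dots,k_n]=[\theta\cdot k_1,\dots,\theta\cdot k_n]$, where $(\theta\cdot k)(z)=k(z\theta)$. A gallery of $w$ is an element of $\{0,1\}^n$. Proposition. For every word $w=s_{i_1}\cdots s_{i_n}$, reduced or not, the map $\gamma\mapsto[\dot s_{i_1}^{\gamma_1},\dots,\dot s_{i_n}^{\gamma_n}]$ is a bijection from the set $\{0,1\}^n$ of galleries of $w$ onto the set of $(T\times S^1)$-fixed points of $M_w$. Hence $M_w$ has exactly $2^n$ fixed points. In particular, if $w$ is reduced, then $M_w$ has exactly $2^{\ell(w)}$ fixed points, where $\ell(w)$ is the least number of simple reflections in a word representing the element $s_{i_1}\cdots s_{i_n}$ of the affine Weyl group. -/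

import Mathlib

/-! ### The group `SU(N)`, its diagonal torus and its loop group -/

/-- The compact group `SU(N)`. -/
abbrev SUGroup (N : ℕ) : Type := Matrix.specialUnitaryGroup (Fin N) ℂ

instance SUGroup.instIsTopologicalGroup (N : ℕ) : IsTopologicalGroup (SUGroup N) where
  continuous_mul := continuous_mul
  continuous_inv := by
    refine Continuous.subtype_mk (f := fun A : SUGroup N => star (A : Matrix (Fin N) (Fin N) ℂ)) ?_ _
    exact continuous_subtype_val.star

/-- The maximal torus `T` of `SU(N)`: the diagonal matrices in `SU(N)`. -/
def maxTorus (N : ℕ) : Subgroup (SUGroup N) where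
  carrier := {g | (g : Matrix (Fin N) (Fin N) ℂ).IsDiag}
  one_mem' := Matrix.isDiag_one
  mul_mem' := by
    intro a b ha hb
    change ((a : Matrix (Fin N) (Fin N) ℂ) * (b : Matrix (Fin N) (Fin N) ℂ)).IsDiag
    rw [← ha.diagonal_diag, ← hb.diagonal_diag, Matrix.diagonal_mul_diagonal]
    exact Matrix.isDiag_diagonal _
  inv_mem' := by
    intro a ha
    exact Matrix.IsDiag.conjTranspose ha

/-- The free loop group `L SU(N)` of continuous maps from the unit circle to `SU(N)`, with
pointwise multiplication and the compact-open topology. -/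
abbrev LoopGroup (N : ℕ) : Type := C(Circle, SUGroup N)

/-- An element of `SU(N)`, as a constant loop. -/
noncomputable def constLoop (N : ℕ) : SUGroup N →* LoopGroup N where
  toFun g := ContinuousMap.const Circle g
  map_one' := rfl
  map_mul' _ _ := rfl

/-- Rotation of free loops: `(θ · γ)(z) = γ(z θ)`. -/
noncomputable def rotateLoop {N : ℕ} (θ : Circle) : LoopGroup N →* LoopGroup N :=
  ContinuousMap.compMonoidHom' ⟨fun z => z * θ, by fun_prop⟩

/-! ### The subgroups `K_(i)` of the loop group -/

/-- The `N × N` matrix that agrees with the identity outside the rows and columns `p`, `q`, and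
whose `(p, q)`-block is `!![a, - conj b * z ^ k; b * z ^ (-k), conj a]`. -/
noncomputable def rootMatrix {N : ℕ} (p q : Fin N) (k : ℤ) (a b : ℂ) (z : Circle) :
    Matrix (Fin N) (Fin N) ℂ :=
  Matrix.of fun r c =>
    if r = p ∧ c = p then a
    else if r = p ∧ c = q then -(starRingEnd ℂ b) * (z : ℂ) ^ k
    else if r = q ∧ c = p then b * (z : ℂ) ^ (-k)
    else if r = q ∧ c = q then starRingEnd ℂ a
    else if r = c then 1 else 0

/-- `K_(e_p - e_q, k)`: the subgroup of the loop group generated by the (constant) maximal torus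
and by the loops with a copy of `SU(2)` in the `(p, q)`-block, twisted by `z ^ k`. -/
noncomputable def rootSubgroup {N : ℕ} (p q : Fin N) (k : ℤ) : Subgroup (LoopGroup N) :=
  Subgroup.closure
    (constLoop N '' (maxTorus N : Set (SUGroup N)) ∪
      {f | ∃ a b : ℂ, ‖a‖ ^ 2 + ‖b‖ ^ 2 = 1 ∧
        ∀ z : Circle, (f z : Matrix (Fin N) (Fin N) ℂ) = rootMatrix p q k a b z})

instance instNeZeroOfFactTwoLe (N : ℕ) [h : Fact (2 ≤ N)] : NeZero N := ⟨by have := h.out; omega⟩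

/-- The affine simple root `α_i` of type `A_{N-1}`, as a triple `(p, q, k)` standing for
`(e_p - e_q, k)`. Coordinates are numbered from `0`, so that `α_i = (e_{i-1} - e_i, 0)` for
`i = 1, …, N - 1`, and `α_0 = (e_{N-1} - e_0, 1)`; the subtraction `i - 1` is modulo `N`. -/
def simpleRoot {N : ℕ} [Fact (2 ≤ N)] (i : Fin N) : Fin N × Fin N × ℤ :=
  (i - 1, i, if i = 0 then 1 else 0)

/-- `K_(i)`, the subgroup of the loop group attached to the affine simple root `α_i`. -/
noncomputable def simpleSubgroup {N : ℕ} [Fact (2 ≤ N)] (i : Fin N) : Subgroup (LoopGroup N) :=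
  rootSubgroup (simpleRoot i).1 (simpleRoot i).2.1 (simpleRoot i).2.2

/-- `K_(i)` contains the constant maximal torus. -/
theorem constLoop_mem_simpleSubgroup {N : ℕ} [Fact (2 ≤ N)] (i : Fin N) (t : maxTorus N) :
    constLoop N t ∈ simpleSubgroup i :=
  Subgroup.subset_closure (Or.inl ⟨t, t.2, rfl⟩)

/-- The inclusion of `T` in `K_(i)` by constant loops. -/
noncomputable def torusIncl {N : ℕ} [Fact (2 ≤ N)] (i : Fin N) : maxTorus N →* simpleSubgroup i :=
  ((constLoop N).comp (maxTorus N).subtype).codRestrict _ (constLoop_mem_simpleSubgroup i)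

/-- `K_(i)` is stable under rotation of loops. -/
theorem rotateLoop_mem_simpleSubgroup {N : ℕ} [Fact (2 ≤ N)] (i : Fin N) (θ : Circle)
    {f : LoopGroup N} (hf : f ∈ simpleSubgroup i) : rotateLoop θ f ∈ simpleSubgroup i := by
  suffices h : simpleSubgroup i ≤ (simpleSubgroup i).comap (rotateLoop θ) from h hf
  refine (Subgroup.closure_le _).2 ?_
  rintro g (⟨t, ht, rfl⟩ | ⟨a, b, hab, hg⟩)
  · exact constLoop_mem_simpleSubgroup i ⟨t, ht⟩
  · refine Subgroup.subset_closure (Or.inr ⟨a, b * (θ : ℂ) ^ (-(simpleRoot i).2.2), ?_, ?_⟩)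
    · have h1 : ‖(θ : ℂ) ^ (-(simpleRoot i).2.2)‖ = 1 := by
        rw [norm_zpow, Circle.norm_coe, one_zpow]
      rw [norm_mul, h1, mul_one, hab]
    · intro z
      refine (hg (z * θ)).trans ?_
      ext r c
      have hθ : starRingEnd ℂ ((θ : ℂ) ^ (-(simpleRoot i).2.2)) = (θ : ℂ) ^ (simpleRoot i).2.2 := by
        rw [map_zpow₀, ← Circle.coe_inv_eq_conj, Circle.coe_inv, zpow_neg, inv_zpow, inv_inv]
      simp only [rootMatrix, Matrix.of_apply, Circle.coe_mul, mul_zpow, map_mul, hθ]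
      split_ifs <;> ring

/-- Rotation of loops on `K_(i)`. -/
noncomputable def rotate {N : ℕ} [Fact (2 ≤ N)] (i : Fin N) (θ : Circle) :
    simpleSubgroup i →* simpleSubgroup i :=
  ((rotateLoop θ).comp (simpleSubgroup i).subtype).codRestrict _
    fun f => rotateLoop_mem_simpleSubgroup i θ f.2

/-! ### The lifts `ṡ_i` of the simple reflections -/

theorem sub_one_ne_self {N : ℕ} [h : Fact (2 ≤ N)] (i : Fin N) : i - 1 ≠ i := by
  have h2 := h.out
  intro hi
  have hv := congrArg Fin.val hi
  rw [Fin.sub_def] at hv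
  have h1 : ((1 : Fin N) : ℕ) = 1 := by
    rw [Fin.val_one', Nat.mod_eq_of_lt (by omega)]
  simp only [h1] at hv
  have hlt := i.2
  rcases Nat.eq_zero_or_pos (i : ℕ) with h0 | h0
  · rw [h0, Nat.mod_eq_of_lt (by omega)] at hv
    omega
  · rw [show N - 1 + (i : ℕ) = (i - 1) + N by omega, Nat.add_mod_right,
      Nat.mod_eq_of_lt (by omega)] at hv
    omega

/-- The `N × 2` matrix with columns `e_p`, `e_q`. -/
noncomputable def pairMatrix {N : ℕ} (p q : Fin N) : Matrix (Fin N) (Fin 2) ℂ :=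
  Matrix.of fun r j => if r = ![p, q] j then 1 else 0

theorem rootMatrix_eq {N : ℕ} {p q : Fin N} (hpq : p ≠ q) (k : ℤ) (a b : ℂ) (z : Circle) :
    rootMatrix p q k a b z = 1 + pairMatrix p q *
      ((!![a, -(starRingEnd ℂ b) * (z : ℂ) ^ k; b * (z : ℂ) ^ (-k), starRingEnd ℂ a] - 1) *
        (pairMatrix p q).transpose) := by
  ext r c
  simp only [rootMatrix, pairMatrix, Matrix.of_apply, Matrix.add_apply, Matrix.mul_apply,
    Matrix.one_apply, Matrix.transpose_apply, Matrix.sub_apply, Fin.sum_univ_two]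
  by_cases h1 : r = p <;> by_cases h2 : r = q <;> by_cases h3 : c = p <;> by_cases h4 : c = q <;>
    simp_all [eq_comm]

theorem pairMatrix_transpose_mul {N : ℕ} {p q : Fin N} (hpq : p ≠ q) :
    (pairMatrix p q).transpose * pairMatrix p q = 1 := by
  ext i j
  fin_cases i <;> fin_cases j <;>
    simp only [pairMatrix, Matrix.mul_apply, Matrix.transpose_apply, Matrix.of_apply, mul_ite,
      mul_one, mul_zero, Finset.sum_ite_eq', Finset.mem_univ, if_true] <;>
    simp [hpq, hpq.symm]

theorem rootMatrix_mem {N : ℕ} {p q : Fin N} (hpq : p ≠ q) (k : ℤ) {a b : ℂ}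
    (hab : ‖a‖ ^ 2 + ‖b‖ ^ 2 = 1) (z : Circle) :
    rootMatrix p q k a b z ∈ Matrix.specialUnitaryGroup (Fin N) ℂ := by
  have hab' : a * starRingEnd ℂ a + b * starRingEnd ℂ b = 1 := by
    rw [Complex.mul_conj', Complex.mul_conj']
    exact_mod_cast hab
  have hz : (z : ℂ) ^ k ≠ 0 := zpow_ne_zero _ (Circle.coe_ne_zero z)
  have hcz : starRingEnd ℂ (z : ℂ) = (z : ℂ)⁻¹ := by
    rw [← Circle.coe_inv_eq_conj, Circle.coe_inv]
  have hU := pairMatrix_transpose_mul hpq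
  have hUs : (pairMatrix p q).conjTranspose = (pairMatrix p q).transpose := by
    ext i j
    simp only [pairMatrix, Matrix.conjTranspose_apply, Matrix.transpose_apply, Matrix.of_apply]
    split_ifs <;> simp
  rw [rootMatrix_eq hpq]
  set A : Matrix (Fin 2) (Fin 2) ℂ :=
    !![a, -(starRingEnd ℂ b) * (z : ℂ) ^ k; b * (z : ℂ) ^ (-k), starRingEnd ℂ a] with hA
  set U := pairMatrix p q with hUdef
  have hdet : A.det = 1 := by
    rw [hA, Matrix.det_fin_two_of, zpow_neg]
    field_simp
    linear_combination hab'
  have hAA : A * star A = 1 := by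
    rw [hA]
    ext i j
    fin_cases i <;> fin_cases j <;>
      simp [Matrix.mul_apply, Fin.sum_univ_two, hcz] <;> field_simp <;>
      first | linear_combination hab' | ring
  have hstar : star (1 + U * ((A - 1) * U.transpose)) =
      1 + U * ((star A - 1) * U.transpose) := by
    simp only [Matrix.star_eq_conjTranspose, Matrix.conjTranspose_add, Matrix.conjTranspose_mul,
      Matrix.conjTranspose_one, Matrix.conjTranspose_sub, hUs, ← Matrix.mul_assoc]
    rw [← hUs, Matrix.conjTranspose_conjTranspose]
  rw [Matrix.mem_specialUnitaryGroup_iff, Matrix.mem_unitaryGroup_iff]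
  constructor
  · rw [hstar]
    have key : U * ((A - 1) * U.transpose) * (U * ((star A - 1) * U.transpose)) =
        U * (((A - 1) * (star A - 1)) * U.transpose) := by
      calc _ = U * ((A - 1) * ((U.transpose * U) * ((star A - 1) * U.transpose))) := by
            simp only [Matrix.mul_assoc]
        _ = _ := by rw [hU, Matrix.one_mul]; simp only [Matrix.mul_assoc]
    have hA2 : (A - 1) * (star A - 1) = (1 - A) + (1 - star A) := by
      rw [sub_mul, mul_sub, hAA, mul_one, one_mul]; abel
    rw [add_mul, mul_add, mul_add, key, hA2, one_mul, mul_one, one_mul]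
    simp only [Matrix.sub_mul, Matrix.add_mul, Matrix.mul_sub, Matrix.mul_add]
    abel
  · rw [Matrix.det_one_add_mul_comm, Matrix.mul_assoc, hU, mul_one, add_sub_cancel, hdet]


theorem continuous_rootMatrix {N : ℕ} (p q : Fin N) (k : ℤ) (a b : ℂ) :
    Continuous fun z : Circle => rootMatrix p q k a b z := by
  refine continuous_matrix fun r c => ?_
  have hz : ∀ m : ℤ, Continuous fun z : Circle => (z : ℂ) ^ m := fun m =>
    (continuous_subtype_val : Continuous fun z : Circle => (z : ℂ)).zpow₀ m fun z => Or.inl (Circle.coe_ne_zero z)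
  simp only [rootMatrix, Matrix.of_apply]
  split_ifs
  · exact continuous_const
  · exact continuous_const.mul (hz k)
  · exact continuous_const.mul (hz (-k))
  all_goals exact continuous_const

/-- The loop in `SU(N)` with the matrix entries of `rootMatrix`. -/
noncomputable def rootLoop {N : ℕ} {p q : Fin N} (hpq : p ≠ q) (k : ℤ) (a b : ℂ)
    (hab : ‖a‖ ^ 2 + ‖b‖ ^ 2 = 1) : LoopGroup N :=
  ⟨fun z => ⟨rootMatrix p q k a b z, rootMatrix_mem hpq k hab z⟩,
    (continuous_rootMatrix p q k a b).subtype_mk _⟩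

/-- The canonical lift `ṡ_i = exp(F) exp(-E) exp(F)` of the simple reflection `s_i` to `K_(i)`,
where `E`, `F` are the root vectors of `α_i` and `-α_i`. In the block of the root it is
`!![0, - z ^ k; z ^ (-k), 0]`. -/
noncomputable def simpleLift {N : ℕ} [Fact (2 ≤ N)] (i : Fin N) : simpleSubgroup i :=
  ⟨rootLoop (p := (simpleRoot i).1) (q := (simpleRoot i).2.1) (sub_one_ne_self i)
      (simpleRoot i).2.2 0 1 (by norm_num),
    Subgroup.subset_closure (Or.inr ⟨0, 1, by norm_num, fun _ => rfl⟩)⟩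

/-! ### Bott–Samelson manifolds and their torus action -/

/-- The product `K_(w 1) × ⋯ × K_(w n)` attached to the word `w`. -/
def BottSamelsonProd {N n : ℕ} [Fact (2 ≤ N)] (w : Fin n → Fin N) : Type :=
  ∀ j : Fin n, simpleSubgroup (w j)

noncomputable instance BottSamelsonProd.instTopologicalSpace {N n : ℕ} [Fact (2 ≤ N)]
    (w : Fin n → Fin N) : TopologicalSpace (BottSamelsonProd w) :=
  inferInstanceAs (TopologicalSpace (∀ j : Fin n, simpleSubgroup (w j)))

/-- The right action of `T ^ n`, written as a left action of the opposite group: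
`(x_1, …, x_n) · (t_1, …, t_n) = (x_1 t_1, t_1⁻¹ x_2 t_2, …, t_{n-1}⁻¹ x_n t_n)`.
Here `Fin.cons 1 t` is the sequence `1, t_1, …, t_n`, so its entry at `j.castSucc` is the
predecessor of the one at `j.succ`. -/
noncomputable instance BottSamelsonProd.instMulAction {N n : ℕ} [Fact (2 ≤ N)]
    (w : Fin n → Fin N) : MulAction (Fin n → maxTorus N)ᵐᵒᵖ (BottSamelsonProd w) where
  smul t x := fun j =>
    (torusIncl (w j) ((Fin.cons 1 t.unop : Fin (n + 1) → maxTorus N) j.castSucc))⁻¹ * x j *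
      torusIncl (w j) (t.unop j)
  one_smul x := by
    funext j
    change (torusIncl (w j)
      ((Fin.cons 1 (1 : Fin n → maxTorus N) : Fin (n + 1) → maxTorus N) j.castSucc))⁻¹ * x j *
        torusIncl (w j) 1 = x j
    have h : (Fin.cons 1 (1 : Fin n → maxTorus N) : Fin (n + 1) → maxTorus N) = 1 := by
      funext m
      refine Fin.cases rfl (fun _ => rfl) m
    simp [h]
  mul_smul t s x := by
    funext j
    change (torusIncl (w j)
        ((Fin.cons 1 (s.unop * t.unop) : Fin (n + 1) → maxTorus N) j.castSucc))⁻¹ * x j *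
          torusIncl (w j) (s.unop j * t.unop j) =
      (torusIncl (w j) ((Fin.cons 1 t.unop : Fin (n + 1) → maxTorus N) j.castSucc))⁻¹ *
        ((torusIncl (w j) ((Fin.cons 1 s.unop : Fin (n + 1) → maxTorus N) j.castSucc))⁻¹ * x j *
          torusIncl (w j) (s.unop j)) * torusIncl (w j) (t.unop j)
    have h : (Fin.cons 1 (s.unop * t.unop) : Fin (n + 1) → maxTorus N) =
        (Fin.cons 1 s.unop : Fin (n + 1) → maxTorus N) * Fin.cons 1 t.unop := by
      funext m
      refine Fin.cases (by simp) (fun _ => by simp) m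
    rw [h]
    simp only [Pi.mul_apply, map_mul, mul_inv_rev, mul_assoc]

/-- The Bott–Samelson manifold `M_w = (K_(w 1) × ⋯ × K_(w n)) / T ^ n`, with the quotient
topology. -/
abbrev BottSamelson {N n : ℕ} [Fact (2 ≤ N)] (w : Fin n → Fin N) : Type :=
  MulAction.orbitRel.Quotient (Fin n → maxTorus N)ᵐᵒᵖ (BottSamelsonProd w)

/-- The class `[x_1, …, x_n]` in the Bott–Samelson manifold. -/
noncomputable def BottSamelson.mk {N n : ℕ} [Fact (2 ≤ N)] (w : Fin n → Fin N) (x : BottSamelsonProd w) :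
    BottSamelson w :=
  Quotient.mk _ x

/-- The action of `(t, θ) ∈ T × S¹` on the product `K_(w 1) × ⋯ × K_(w n)`: rotation by `θ` in
every factor, followed by left multiplication by `t` in the first factor. -/
noncomputable def torusAct {N n : ℕ} [Fact (2 ≤ N)] (w : Fin n → Fin N)
    (g : maxTorus N × Circle) (x : BottSamelsonProd w) : BottSamelsonProd w := fun j =>
  if j.val = 0 then torusIncl (w j) g.1 * rotate (w j) g.2 (x j) else rotate (w j) g.2 (x j)

theorem rotate_torusIncl {N : ℕ} [Fact (2 ≤ N)] (i : Fin N) (θ : Circle) (t : maxTorus N) :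
    rotate i θ (torusIncl i t) = torusIncl i t := rfl

theorem rotate_one {N : ℕ} [Fact (2 ≤ N)] (i : Fin N) (f : simpleSubgroup i) :
    rotate i 1 f = f := by
  refine Subtype.ext (ContinuousMap.ext fun z => ?_)
  change (f : LoopGroup N) (z * 1) = (f : LoopGroup N) z
  rw [mul_one]

theorem rotate_mul {N : ℕ} [Fact (2 ≤ N)] (i : Fin N) (θ φ : Circle) (f : simpleSubgroup i) :
    rotate i (θ * φ) f = rotate i θ (rotate i φ f) := by
  refine Subtype.ext (ContinuousMap.ext fun z => ?_)
  change (f : LoopGroup N) (z * (θ * φ)) = (f : LoopGroup N) (z * θ * φ)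
  rw [mul_assoc]

theorem torusAct_smul {N n : ℕ} [Fact (2 ≤ N)] (w : Fin n → Fin N) (g : maxTorus N × Circle)
    (t : (Fin n → maxTorus N)ᵐᵒᵖ) (x : BottSamelsonProd w) :
    torusAct w g (t • x) = t • torusAct w g x := by
  funext j
  change (if j.val = 0 then torusIncl (w j) g.1 * rotate (w j) g.2
      ((torusIncl (w j) ((Fin.cons 1 t.unop : Fin (n + 1) → maxTorus N) j.castSucc))⁻¹ * x j *
        torusIncl (w j) (t.unop j)) else rotate (w j) g.2
      ((torusIncl (w j) ((Fin.cons 1 t.unop : Fin (n + 1) → maxTorus N) j.castSucc))⁻¹ * x j *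
        torusIncl (w j) (t.unop j))) =
    (torusIncl (w j) ((Fin.cons 1 t.unop : Fin (n + 1) → maxTorus N) j.castSucc))⁻¹ *
      (if j.val = 0 then torusIncl (w j) g.1 * rotate (w j) g.2 (x j)
        else rotate (w j) g.2 (x j)) * torusIncl (w j) (t.unop j)
  simp only [map_mul, map_inv, rotate_torusIncl]
  split_ifs with h
  · have h0 : j.castSucc = 0 := Fin.ext h
    rw [h0, Fin.cons_zero]
    simp [mul_assoc]
  · rfl

/-- The action of `T × S¹` on the Bott–Samelson manifold:
`(t, θ) · [k_1, …, k_n] = [t (θ · k_1), θ · k_2, …, θ · k_n]`. -/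
noncomputable instance BottSamelson.instMulAction {N n : ℕ} [Fact (2 ≤ N)] (w : Fin n → Fin N) :
    MulAction (maxTorus N × Circle) (BottSamelson w) where
  smul g := Quotient.map (torusAct w g) fun x y ⟨t, ht⟩ =>
    ⟨t, by rw [← ht]; exact (torusAct_smul w g t y).symm⟩
  one_smul m := by
    refine Quotient.inductionOn m fun x => congrArg (Quotient.mk _) ?_
    funext j
    simp [torusAct, rotate_one]
  mul_smul g h m := by
    refine Quotient.inductionOn m fun x => congrArg (Quotient.mk _) ?_
    funext j
    change (if j.val = 0 then torusIncl (w j) (g.1 * h.1) * rotate (w j) (g.2 * h.2) (x j)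
        else rotate (w j) (g.2 * h.2) (x j)) =
      if j.val = 0 then torusIncl (w j) g.1 * rotate (w j) g.2
          (if j.val = 0 then torusIncl (w j) h.1 * rotate (w j) h.2 (x j)
            else rotate (w j) h.2 (x j))
        else rotate (w j) g.2
          (if j.val = 0 then torusIncl (w j) h.1 * rotate (w j) h.2 (x j)
            else rotate (w j) h.2 (x j))
    split_ifs
    · rw [map_mul, map_mul, rotate_mul, rotate_torusIncl, mul_assoc]
    · rw [rotate_mul]

/-! ### Galleries -/

/-- A gallery of a word of length `n`: an element of `{0, 1} ^ n`. -/
abbrev Gallery (n : ℕ) : Type := Fin n → Fin 2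

/-- The point `[ṡ_{w 1} ^ γ_1, …, ṡ_{w n} ^ γ_n]` of the Bott–Samelson manifold. -/
noncomputable def galleryPoint {N n : ℕ} [Fact (2 ≤ N)] (w : Fin n → Fin N) (γ : Gallery n) :
    BottSamelson w :=
  BottSamelson.mk w fun j => simpleLift (w j) ^ (γ j : ℕ)

/-! ### The affine Weyl group, length and reduced words -/

/-- The coroot lattice `Q` of `SU(N)`: integer vectors with coordinate sum zero. -/
def corootLattice (N : ℕ) : AddSubgroup (Fin N → ℤ) where
  carrier := {v | ∑ i, v i = 0}
  zero_mem' := by simp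
  add_mem' := by
    intro a b ha hb
    simp only [Set.mem_ofPred_eq] at ha hb ⊢
    simp [Finset.sum_add_distrib, ha, hb]
  neg_mem' := by
    intro a ha
    simp only [Set.mem_ofPred_eq] at ha ⊢
    simp [ha]

/-- The action of a permutation on the coroot lattice, `(σ v)_i = v_{σ⁻¹ i}`. -/
def permCoroot {N : ℕ} (σ : Equiv.Perm (Fin N)) : corootLattice N ≃+ corootLattice N where
  toFun v := ⟨fun i => v.1 (σ⁻¹ i), (Equiv.sum_comp σ⁻¹ v.1).trans v.2⟩
  invFun v := ⟨fun i => v.1 (σ i), (Equiv.sum_comp σ v.1).trans v.2⟩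
  left_inv v := Subtype.ext (funext fun i => by simp)
  right_inv v := Subtype.ext (funext fun i => by simp)
  map_add' _ _ := rfl

/-- The action of the finite Weyl group on the coroot lattice, written multiplicatively. -/
def weylAction (N : ℕ) : Equiv.Perm (Fin N) →* MulAut (Multiplicative (corootLattice N)) where
  toFun σ := AddEquiv.toMultiplicative (permCoroot σ)
  map_one' := rfl
  map_mul' _ _ := rfl

/-- The affine Weyl group of type `A_{N-1}`, the semidirect product of the finite Weyl group
`S_N` with the coroot lattice. -/
abbrev AffineWeyl (N : ℕ) : Type := Multiplicative (corootLattice N) ⋊[weylAction N]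
  Equiv.Perm (Fin N)

/-- The coroot `e_p - e_q`. -/
def coroot {N : ℕ} (p q : Fin N) : corootLattice N :=
  ⟨Pi.single p 1 - Pi.single q 1, by
    change ∑ i, (Pi.single p 1 - Pi.single q 1 : Fin N → ℤ) i = 0
    simp [Finset.sum_sub_distrib]⟩

/-- The simple reflections: `s_i` is the reflection in `α_i = e_{i-1} - e_i` for `i ≠ 0`, and
`s_0 = r_θ t^(-θ^∨)`, where `θ = e_0 - e_{N-1}` is the highest root. -/
def simpleReflection {N : ℕ} [Fact (2 ≤ N)] (i : Fin N) : AffineWeyl N :=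
  if i = 0 then
    SemidirectProduct.inr (Equiv.swap 0 (0 - 1)) *
      SemidirectProduct.inl (Multiplicative.ofAdd (-coroot 0 (0 - 1)))
  else SemidirectProduct.inr (Equiv.swap (i - 1) i)

/-- The element `s_{w 1} ⋯ s_{w n}` of the affine Weyl group. -/
def wordProd {N n : ℕ} [Fact (2 ≤ N)] (w : Fin n → Fin N) : AffineWeyl N :=
  (List.ofFn fun j => simpleReflection (w j)).prod

/-- The length of an element of the affine Weyl group: the least number of simple reflections
in a word for it. -/
noncomputable def weylLength {N : ℕ} [Fact (2 ≤ N)] (u : AffineWeyl N) : ℕ :=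
  sInf {m | ∃ v : Fin m → Fin N, wordProd v = u}

/-- A word is reduced if no shorter word represents the same element. -/
def IsReducedWord {N n : ℕ} [Fact (2 ≤ N)] (w : Fin n → Fin N) : Prop :=
  weylLength (wordProd w) = n

/-! The whole question reduces to the normalizer of `T` in one factor `K_(i)`. The block loops form
a copy of `SU(2)` normalized by `T`, so every element of `K_(i)` is a torus element times a block
loop (`exists_eq_torusIncl_mul_rootElement`). A block loop with both `a` and `b` nonzero does not
normalize `T`, hence the normalizer is the disjoint union of the cosets `T` and `ṡ_i T`
(`exists_isLiftOf_of_normalizes`, `IsLiftOf.unique`).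

These cosets are stable under multiplication by `T` on either side and under rotation. So the class
of `x` is a gallery point as soon as each `x_j` lies in some `ṡ_{w j}^m T`, gallery points are
fixed, and the exponents can be read off from the class.

Conversely, if the class of `x` is fixed by `s ∈ T`, there are torus elements `v_0 = s, v_1, …` with
`v_j x_j = x_j v_{j+1}` (factors numbered from 0). As `s` varies, `x_0` is seen to normalize `T`;
conjugation by it maps `T` onto `T`, so `v_1` is arbitrary, and the argument passes to the next
factor. This direction uses only the action of `T`; rotations enter only in showing that gallery
points are fixed. -/

section BottSamelsonFixedPoints

variable {N : ℕ}

/-! ### Multiplication in the block and in the torus -/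

/-- Since `Uᵀ U = 1`, the map `A ↦ 1 + U (A - 1) Uᵀ` is multiplicative. The powers of `z` cancel in
the diagonal entries, so the new parameters do not depend on `z`. -/
theorem rootMatrix_mul {p q : Fin N} (hpq : p ≠ q) (k : ℤ) (a b c d : ℂ) (z : Circle) :
    rootMatrix p q k a b z * rootMatrix p q k c d z =
      rootMatrix p q k (a * c - starRingEnd ℂ b * d) (b * c + starRingEnd ℂ a * d) z := by
  have hz : (z : ℂ) ≠ 0 := Circle.coe_ne_zero z
  have hU := pairMatrix_transpose_mul hpq
  rw [rootMatrix_eq hpq, rootMatrix_eq hpq, rootMatrix_eq hpq]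
  set U := pairMatrix p q
  set A : Matrix (Fin 2) (Fin 2) ℂ :=
    !![a, -(starRingEnd ℂ b) * (z : ℂ) ^ k; b * (z : ℂ) ^ (-k), starRingEnd ℂ a] with hA
  set B : Matrix (Fin 2) (Fin 2) ℂ :=
    !![c, -(starRingEnd ℂ d) * (z : ℂ) ^ k; d * (z : ℂ) ^ (-k), starRingEnd ℂ c] with hB
  have hAB : !![a * c - starRingEnd ℂ b * d,
      -(starRingEnd ℂ (b * c + starRingEnd ℂ a * d)) * (z : ℂ) ^ k;
      (b * c + starRingEnd ℂ a * d) * (z : ℂ) ^ (-k),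
      starRingEnd ℂ (a * c - starRingEnd ℂ b * d)] = A * B := by
    have hzk : (z : ℂ) ^ k ≠ 0 := zpow_ne_zero _ hz
    rw [hA, hB, zpow_neg]
    ext i j
    fin_cases i <;> fin_cases j <;> simp [Matrix.mul_apply, Fin.sum_univ_two] <;>
      field_simp <;> ring
  rw [hAB]
  have key : U * ((A - 1) * U.transpose) * (U * ((B - 1) * U.transpose)) =
      U * (((A - 1) * (B - 1)) * U.transpose) := by
    calc _ = U * ((A - 1) * ((U.transpose * U) * ((B - 1) * U.transpose))) := by
          simp only [Matrix.mul_assoc]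
      _ = _ := by rw [hU, Matrix.one_mul]; simp only [Matrix.mul_assoc]
  have h2 : A * B - 1 = (A - 1) * (B - 1) + (A - 1) + (B - 1) := by noncomm_ring
  rw [add_mul, mul_add, mul_add, key, h2, one_mul, mul_one, one_mul]
  simp only [Matrix.add_mul, Matrix.mul_add]
  abel

theorem norm_sq_add_norm_sq_mul {a b c d : ℂ} (hab : ‖a‖ ^ 2 + ‖b‖ ^ 2 = 1)
    (hcd : ‖c‖ ^ 2 + ‖d‖ ^ 2 = 1) :
    ‖a * c - starRingEnd ℂ b * d‖ ^ 2 + ‖b * c + starRingEnd ℂ a * d‖ ^ 2 = 1 := by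
  have key : ‖a * c - starRingEnd ℂ b * d‖ ^ 2 + ‖b * c + starRingEnd ℂ a * d‖ ^ 2 =
      (‖a‖ ^ 2 + ‖b‖ ^ 2) * (‖c‖ ^ 2 + ‖d‖ ^ 2) := by
    simp only [Complex.sq_norm, Complex.normSq_apply, Complex.sub_re, Complex.sub_im,
      Complex.add_re, Complex.add_im, Complex.mul_re, Complex.mul_im, Complex.conj_re,
      Complex.conj_im]
    ring
  rw [key, hab, hcd, one_mul]

theorem maxTorus_mul_comm (s t : maxTorus N) : s * t = t * s := by
  refine Subtype.ext (Subtype.ext ?_)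
  change (s : Matrix (Fin N) (Fin N) ℂ) * (t : Matrix (Fin N) (Fin N) ℂ) =
    (t : Matrix (Fin N) (Fin N) ℂ) * (s : Matrix (Fin N) (Fin N) ℂ)
  rw [← Matrix.IsDiag.diagonal_diag s.2, ← Matrix.IsDiag.diagonal_diag t.2,
    Matrix.diagonal_mul_diagonal, Matrix.diagonal_mul_diagonal]
  simp only [mul_comm]

theorem norm_maxTorus_apply (t : maxTorus N) (r : Fin N) :
    ‖(t : Matrix (Fin N) (Fin N) ℂ) r r‖ = 1 := by
  have h := Matrix.mem_unitaryGroup_iff.1 (Matrix.mem_specialUnitaryGroup_iff.1 t.1.2).1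
  rw [← Matrix.IsDiag.diagonal_diag t.2, Matrix.star_eq_conjTranspose,
    Matrix.diagonal_conjTranspose, Matrix.diagonal_mul_diagonal] at h
  have h' := congrFun (congrFun h r) r
  simp only [Matrix.diagonal_apply_eq, Matrix.one_apply_eq, Matrix.diag_apply, Pi.star_apply,
    RCLike.star_def, Complex.mul_conj'] at h'
  have h2 : ‖(t : Matrix (Fin N) (Fin N) ℂ) r r‖ ^ 2 = 1 := by exact_mod_cast h'
  exact (pow_eq_one_iff_of_nonneg (norm_nonneg _) two_ne_zero).1 h2

variable [Fact (2 ≤ N)]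

/-! ### Structure of `K_(i)`: the block loops and the torus -/

/-- The element of `K_(i)` given by a matrix of `SU(2)` in the block of the root `α_i`. -/
noncomputable def rootElement (i : Fin N) (a b : ℂ) (hab : ‖a‖ ^ 2 + ‖b‖ ^ 2 = 1) :
    simpleSubgroup i :=
  ⟨rootLoop (p := (simpleRoot i).1) (q := (simpleRoot i).2.1) (sub_one_ne_self i)
      (simpleRoot i).2.2 a b hab,
    Subgroup.subset_closure (Or.inr ⟨a, b, hab, fun _ => rfl⟩)⟩

theorem simpleSubgroup_ext {i : Fin N} {x y : simpleSubgroup i}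
    (h : ∀ z, ((x : LoopGroup N) z : Matrix (Fin N) (Fin N) ℂ) = (y : LoopGroup N) z) : x = y :=
  Subtype.ext (ContinuousMap.ext fun z => Subtype.ext (h z))

theorem rootElement_mul (i : Fin N) {a b c d : ℂ} (hab : ‖a‖ ^ 2 + ‖b‖ ^ 2 = 1)
    (hcd : ‖c‖ ^ 2 + ‖d‖ ^ 2 = 1) :
    rootElement i a b hab * rootElement i c d hcd =
      rootElement i (a * c - starRingEnd ℂ b * d) (b * c + starRingEnd ℂ a * d)
        (norm_sq_add_norm_sq_mul hab hcd) :=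
  simpleSubgroup_ext fun z => rootMatrix_mul (sub_one_ne_self i) _ a b c d z

theorem rootElement_one (i : Fin N) : rootElement i 1 0 (by norm_num) = 1 := by
  refine simpleSubgroup_ext fun z => ?_
  change rootMatrix (i - 1) i _ 1 0 z = 1
  rw [rootMatrix_eq (sub_one_ne_self i)]
  simp [← Matrix.one_fin_two]

theorem rootElement_inv (i : Fin N) {a b : ℂ} (hab : ‖a‖ ^ 2 + ‖b‖ ^ 2 = 1) :
    (rootElement i a b hab)⁻¹ = rootElement i (starRingEnd ℂ a) (-b) (by simpa using hab) := by
  have hab' : a * starRingEnd ℂ a + b * starRingEnd ℂ b = 1 := by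
    rw [Complex.mul_conj', Complex.mul_conj']
    exact_mod_cast hab
  rw [inv_eq_iff_mul_eq_one, rootElement_mul, ← rootElement_one i]
  congr 1
  · linear_combination hab'
  · ring

/-- The diagonal matrix with entries `c`, `conj c` in the block of the root `α_i`. -/
noncomputable def corootElement (i : Fin N) (c : ℂ) (hc : ‖c‖ = 1) : maxTorus N :=
  ⟨⟨rootMatrix (i - 1) i 0 c 0 1, rootMatrix_mem (sub_one_ne_self i) 0 (by simp [hc]) 1⟩, by
    intro r s hrs
    have h1 : ¬ (r = i - 1 ∧ s = i - 1) := fun h => hrs (h.1.trans h.2.symm)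
    have h2 : ¬ (r = i ∧ s = i) := fun h => hrs (h.1.trans h.2.symm)
    simp [rootMatrix, h1, h2, hrs]⟩

theorem torusIncl_corootElement (i : Fin N) {c : ℂ} (hc : ‖c‖ = 1) :
    torusIncl i (corootElement i c hc) = rootElement i c 0 (by simp [hc]) := by
  refine simpleSubgroup_ext fun z => ?_
  change rootMatrix (i - 1) i 0 c 0 1 = rootMatrix (i - 1) i _ c 0 z
  ext r s
  simp [rootMatrix]

theorem simpleLift_eq (i : Fin N) : simpleLift i = rootElement i 0 1 (by norm_num) := rfl

theorem torusIncl_injective (i : Fin N) : Function.Injective (torusIncl i) := by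
  intro s t h
  exact Subtype.ext (congrArg (fun x : simpleSubgroup i => (x : LoopGroup N) 1) h)

theorem torusIncl_apply (i : Fin N) (t : maxTorus N) (z : Circle) :
    ((torusIncl i t : LoopGroup N) z : Matrix (Fin N) (Fin N) ℂ) =
      Matrix.diagonal (t : Matrix (Fin N) (Fin N) ℂ).diag :=
  (Matrix.IsDiag.diagonal_diag t.2).symm

/-- The value at `t` of the character of `T` attached to the negative of the finite part of
the root `α_i`. -/
noncomputable def negRootChar (i : Fin N) (t : maxTorus N) : ℂ :=
  (t : Matrix (Fin N) (Fin N) ℂ) i i / (t : Matrix (Fin N) (Fin N) ℂ) (i - 1) (i - 1)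

theorem norm_negRootChar (i : Fin N) (t : maxTorus N) : ‖negRootChar i t‖ = 1 := by
  rw [negRootChar, norm_div, norm_maxTorus_apply, norm_maxTorus_apply, div_one]

/-- The torus normalizes the block loops: conjugation by `t` fixes the diagonal and scales the lower
left entry by a character. This is the commutation rule behind all later computations in `K_(i)`. -/
theorem torusIncl_mul_rootElement (i : Fin N) (t : maxTorus N) {a b : ℂ}
    (hab : ‖a‖ ^ 2 + ‖b‖ ^ 2 = 1) :
    torusIncl i t * rootElement i a b hab =
      rootElement i a (b * negRootChar i t) (by rw [norm_mul, norm_negRootChar, mul_one, hab]) *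
        torusIncl i t := by
  refine simpleSubgroup_ext fun z => ?_
  change ((torusIncl i t : LoopGroup N) z : Matrix (Fin N) (Fin N) ℂ) *
      rootMatrix (i - 1) i _ a b z = rootMatrix (i - 1) i _ a (b * negRootChar i t) z *
    ((torusIncl i t : LoopGroup N) z : Matrix (Fin N) (Fin N) ℂ)
  rw [torusIncl_apply]
  have hp := norm_maxTorus_apply t (i - 1)
  have hq := norm_maxTorus_apply t i
  ext r s
  rw [Matrix.diagonal_mul, Matrix.mul_diagonal]
  simp only [Matrix.diag_apply, rootMatrix, Matrix.of_apply, negRootChar, map_mul, map_div₀]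
  have hp0 : (t : Matrix (Fin N) (Fin N) ℂ) (i - 1) (i - 1) ≠ 0 := norm_ne_zero_iff.1 (by simp [hp])
  have hq0 : (t : Matrix (Fin N) (Fin N) ℂ) i i ≠ 0 := norm_ne_zero_iff.1 (by simp [hq])
  have hp1 : starRingEnd ℂ ((t : Matrix (Fin N) (Fin N) ℂ) (i - 1) (i - 1)) =
      ((t : Matrix (Fin N) (Fin N) ℂ) (i - 1) (i - 1))⁻¹ := by
    rw [Complex.inv_eq_conj hp]
  have hq1 : starRingEnd ℂ ((t : Matrix (Fin N) (Fin N) ℂ) i i) =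
      ((t : Matrix (Fin N) (Fin N) ℂ) i i)⁻¹ := by
    rw [Complex.inv_eq_conj hq]
  rw [hp1, hq1]
  split_ifs with h1 h2 h3 h4 h5
  · rw [h1.1, h1.2]; ring
  · rw [h2.1, h2.2]; field_simp
  · rw [h3.1, h3.2]; field_simp
  · rw [h4.1, h4.2]; ring
  · rw [h5]; ring
  · ring

theorem exists_eq_torusIncl_mul_rootElement (i : Fin N) (x : simpleSubgroup i) :
    ∃ (t : maxTorus N) (a b : ℂ) (hab : ‖a‖ ^ 2 + ‖b‖ ^ 2 = 1),
      x = torusIncl i t * rootElement i a b hab := by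
  obtain ⟨x, hx⟩ := x
  induction hx using Subgroup.closure_induction with
  | mem x hx =>
    rcases hx with ⟨t, ht, rfl⟩ | ⟨a, b, hab, h⟩
    · exact ⟨⟨t, ht⟩, 1, 0, by norm_num, by rw [rootElement_one, mul_one]; rfl⟩
    · exact ⟨1, a, b, hab, by rw [map_one, one_mul]; exact simpleSubgroup_ext h⟩
  | one => exact ⟨1, 1, 0, by norm_num, by rw [rootElement_one, map_one, mul_one]; rfl⟩
  | mul x y hx hy ihx ihy =>
    obtain ⟨s, a, b, hab, hx'⟩ := ihx
    obtain ⟨t, c, d, hcd, hy'⟩ := ihy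
    -- Taken at `t⁻¹` so that, once inverses are cleared, it moves `t` from the right of the first
    -- block loop to its left.
    have hc := torusIncl_mul_rootElement i t⁻¹ hab
    have hab' : ‖a‖ ^ 2 + ‖b * negRootChar i t⁻¹‖ ^ 2 = 1 := by
      rw [norm_mul, norm_negRootChar, mul_one, hab]
    refine ⟨s * t, _, _, norm_sq_add_norm_sq_mul hab' hcd, ?_⟩
    rw [← rootElement_mul i hab' hcd]
    refine Eq.trans (congrArg₂ (· * ·) hx' hy' : _) ?_
    rw [map_inv, inv_mul_eq_iff_eq_mul, ← mul_assoc, ← mul_inv_eq_iff_eq_mul, inv_inv] at hc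
    rw [map_mul, mul_assoc, ← mul_assoc _ (torusIncl i t), hc]
    simp only [mul_assoc]
  | inv x hx ih =>
    obtain ⟨t, a, b, hab, hx'⟩ := ih
    refine ⟨t⁻¹, starRingEnd ℂ a, -b * negRootChar i t, by
      rw [norm_mul, norm_negRootChar, mul_one]; simpa using hab, ?_⟩
    refine Eq.trans (congrArg (·⁻¹) hx' : _) ?_
    have hc := torusIncl_mul_rootElement i t (a := starRingEnd ℂ a) (b := -b) (by simpa using hab)
    rw [mul_inv_rev, rootElement_inv, map_inv, eq_inv_mul_iff_mul_eq, ← mul_assoc, hc,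
      mul_inv_cancel_right]

theorem rootElement_zero_left (i : Fin N) {b : ℂ} (hb : ‖b‖ = 1) :
    rootElement i 0 b (by simp [hb]) = simpleLift i * torusIncl i (corootElement i b hb) := by
  rw [torusIncl_corootElement, simpleLift_eq, rootElement_mul]
  congr 1 <;> simp

/-! ### The cosets `T` and `ṡ_i T` as the normalizer of `T` -/

/-- `x` lies in the coset `ṡ_i ^ m T`. -/
def IsLiftOf (i : Fin N) (m : Fin 2) (x : simpleSubgroup i) : Prop :=
  ∃ t : maxTorus N, x = simpleLift i ^ (m : ℕ) * torusIncl i t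

theorem isLiftOf_zero_iff {i : Fin N} {x : simpleSubgroup i} :
    IsLiftOf i 0 x ↔ ∃ t : maxTorus N, x = torusIncl i t := by
  simp [IsLiftOf]

theorem isLiftOf_one_iff {i : Fin N} {x : simpleSubgroup i} :
    IsLiftOf i 1 x ↔ ∃ t : maxTorus N, x = simpleLift i * torusIncl i t := by
  simp [IsLiftOf]

theorem IsLiftOf.torusIncl_mul {i : Fin N} {m : Fin 2} {x : simpleSubgroup i}
    (hx : IsLiftOf i m x) (s : maxTorus N) : IsLiftOf i m (torusIncl i s * x) := by
  match m with
  | 0 =>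
    obtain ⟨t, rfl⟩ := isLiftOf_zero_iff.1 hx
    exact isLiftOf_zero_iff.2 ⟨s * t, by rw [map_mul]⟩
  | 1 =>
    obtain ⟨t, rfl⟩ := isLiftOf_one_iff.1 hx
    refine isLiftOf_one_iff.2 ⟨corootElement i _ (norm_negRootChar i s) * s * t, ?_⟩
    rw [simpleLift_eq, ← mul_assoc, torusIncl_mul_rootElement]
    simp only [one_mul]
    rw [rootElement_zero_left i (norm_negRootChar i s), ← simpleLift_eq]
    simp only [map_mul, mul_assoc]

theorem norm_circle_zpow (θ : Circle) (k : ℤ) : ‖(θ : ℂ) ^ k‖ = 1 := by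
  rw [norm_zpow, Circle.norm_coe, one_zpow]

/-- Rotation only changes the phase of `b`, and by `rootElement_zero_left` a phase is a torus factor
on the right; hence `ṡ_i T` is stable under rotation. -/
theorem rotate_simpleLift (i : Fin N) (θ : Circle) :
    rotate i θ (simpleLift i) = rootElement i 0 ((θ : ℂ) ^ (-(simpleRoot i).2.2))
      (by rw [norm_circle_zpow]; simp) := by
  refine simpleSubgroup_ext fun z => ?_
  change rootMatrix _ _ _ 0 1 (z * θ) = rootMatrix _ _ _ 0 _ z
  have hθ : starRingEnd ℂ ((θ : ℂ) ^ (-(simpleRoot i).2.2)) = (θ : ℂ) ^ (simpleRoot i).2.2 := by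
    rw [map_zpow₀, ← Circle.coe_inv_eq_conj, Circle.coe_inv, zpow_neg, inv_zpow, inv_inv]
  ext r c
  simp only [rootMatrix, Matrix.of_apply, Circle.coe_mul, mul_zpow, map_one, hθ]
  split_ifs <;> ring

theorem IsLiftOf.rotate {i : Fin N} {m : Fin 2} {x : simpleSubgroup i}
    (hx : IsLiftOf i m x) (θ : Circle) : IsLiftOf i m (rotate i θ x) := by
  match m with
  | 0 =>
    obtain ⟨t, rfl⟩ := isLiftOf_zero_iff.1 hx
    exact isLiftOf_zero_iff.2 ⟨t, rotate_torusIncl i θ t⟩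
  | 1 =>
    obtain ⟨t, rfl⟩ := isLiftOf_one_iff.1 hx
    refine isLiftOf_one_iff.2 ⟨corootElement i _ (norm_circle_zpow θ (-(simpleRoot i).2.2)) * t, ?_⟩
    rw [map_mul, rotate_torusIncl, rotate_simpleLift, rootElement_zero_left i (norm_circle_zpow θ _),
      map_mul, mul_assoc]

theorem isLiftOf_simpleLift_pow (i : Fin N) (m : Fin 2) : IsLiftOf i m (simpleLift i ^ (m : ℕ)) :=
  ⟨1, by rw [map_one, mul_one]⟩

/-- Conjugation by such an `x` maps `T` onto `T`; the surjectivity drives the induction along the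
word. -/
theorem IsLiftOf.exists_torusIncl_mul_eq {i : Fin N} {m : Fin 2} {x : simpleSubgroup i}
    (hx : IsLiftOf i m x) (t : maxTorus N) :
    ∃ s : maxTorus N, torusIncl i s * x = x * torusIncl i t := by
  obtain ⟨u, rfl⟩ := hx
  match m with
  | 0 => exact ⟨t, by simp [← map_mul, maxTorus_mul_comm]⟩
  | 1 =>
    have hc := torusIncl_mul_rootElement i t⁻¹ (a := 0) (b := 1) (by norm_num)
    have hn := norm_negRootChar i t⁻¹
    have hs : rootElement i 0 (1 * negRootChar i t⁻¹) (by simp [hn]) =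
        torusIncl i (corootElement i (starRingEnd ℂ (negRootChar i t⁻¹)) (by simpa using hn)) *
          simpleLift i := by
      rw [torusIncl_corootElement, simpleLift_eq, rootElement_mul]
      congr 1 <;> simp
    rw [hs, ← simpleLift_eq, map_inv, inv_mul_eq_iff_eq_mul, ← mul_assoc, ← mul_assoc,
      eq_mul_inv_iff_mul_eq, ← map_mul] at hc
    refine ⟨t * corootElement i (starRingEnd ℂ (negRootChar i t⁻¹)) (by simpa using hn), ?_⟩
    rw [Fin.val_one, pow_one, mul_assoc, ← map_mul (torusIncl i), maxTorus_mul_comm u t,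
      map_mul _ t u, ← mul_assoc (simpleLift i), hc, mul_assoc]

theorem exists_isLiftOf_of_normalizes {i : Fin N} (x : simpleSubgroup i)
    (hx : ∀ s : maxTorus N, ∃ t : maxTorus N, torusIncl i s * x = x * torusIncl i t) :
    ∃ m, IsLiftOf i m x := by
  obtain ⟨τ, a, b, hab, rfl⟩ := exists_eq_torusIncl_mul_rootElement i x
  -- One test element suffices: its block entries `I` and `-I` are distinct. Column `i - 1` of the
  -- relation at `z = 1` gives `I a = a t_{i-1}` and `-I b = b t_{i-1}`, so `a` or `b` vanishes.
  obtain ⟨t, ht⟩ := hx (corootElement i Complex.I Complex.norm_I)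
  rw [← mul_assoc, ← map_mul, maxTorus_mul_comm, map_mul, mul_assoc, mul_assoc, mul_right_inj] at ht
  have hm : rootMatrix (i - 1) i 0 Complex.I 0 1 * rootMatrix (i - 1) i _ a b 1 =
      rootMatrix (i - 1) i _ a b 1 *
        ((torusIncl i t : LoopGroup N) 1 : Matrix (Fin N) (Fin N) ℂ) :=
    congrArg (fun x : simpleSubgroup i =>
      ((x : LoopGroup N) 1 : Matrix (Fin N) (Fin N) ℂ)) ht
  have hd : rootMatrix (i - 1) i 0 Complex.I 0 1 =
      Matrix.diagonal (rootMatrix (i - 1) i 0 Complex.I 0 1).diag :=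
    (Matrix.IsDiag.diagonal_diag (corootElement i Complex.I Complex.norm_I).2).symm
  rw [torusIncl_apply, hd] at hm
  have hne := sub_one_ne_self i
  have h1 := congrFun (congrFun hm (i - 1)) (i - 1)
  have h2 := congrFun (congrFun hm i) (i - 1)
  rw [Matrix.diagonal_mul, Matrix.mul_diagonal] at h1 h2
  simp [rootMatrix, hne.symm] at h1 h2
  rcases eq_or_ne b 0 with rfl | hb
  · have ha : ‖a‖ = 1 :=
      (pow_eq_one_iff_of_nonneg (norm_nonneg _) two_ne_zero).1 (by simpa using hab)
    exact ⟨0, isLiftOf_zero_iff.2 ⟨τ * corootElement i a ha, by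
      rw [map_mul, torusIncl_corootElement]⟩⟩
  rcases eq_or_ne a 0 with rfl | ha
  · have hb : ‖b‖ = 1 :=
      (pow_eq_one_iff_of_nonneg (norm_nonneg _) two_ne_zero).1 (by simpa using hab)
    exact ⟨1, (isLiftOf_one_iff.2 ⟨_, rootElement_zero_left i hb⟩).torusIncl_mul τ⟩
  exfalso
  have e1 : Complex.I = (t : Matrix (Fin N) (Fin N) ℂ) (i - 1) (i - 1) :=
    mul_left_cancel₀ ha (by linear_combination h1)
  have e2 : -Complex.I = (t : Matrix (Fin N) (Fin N) ℂ) (i - 1) (i - 1) :=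
    mul_left_cancel₀ hb (by linear_combination h2)
  have := congrArg Complex.im (e1.trans e2.symm)
  norm_num at this

theorem simpleLift_ne_torusIncl (i : Fin N) (t : maxTorus N) : simpleLift i ≠ torusIncl i t := by
  intro h
  have hm : rootMatrix (i - 1) i _ 0 1 1 =
      ((torusIncl i t : LoopGroup N) 1 : Matrix (Fin N) (Fin N) ℂ) :=
    congrArg (fun x : simpleSubgroup i => ((x : LoopGroup N) 1 : Matrix (Fin N) (Fin N) ℂ)) h
  have hne := sub_one_ne_self i
  have h1 := congrFun (congrFun hm i) (i - 1)
  rw [torusIncl_apply, Matrix.diagonal_apply_ne _ hne.symm] at h1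
  simp [rootMatrix, hne.symm] at h1

theorem IsLiftOf.unique {i : Fin N} {m m' : Fin 2} {x : simpleSubgroup i}
    (h : IsLiftOf i m x) (h' : IsLiftOf i m' x) : m = m' := by
  have key : ¬ (IsLiftOf i 0 x ∧ IsLiftOf i 1 x) := by
    rintro ⟨h0, h1⟩
    obtain ⟨s, rfl⟩ := isLiftOf_zero_iff.1 h0
    obtain ⟨t, ht⟩ := isLiftOf_one_iff.1 h1
    refine simpleLift_ne_torusIncl i (s * t⁻¹) ?_
    rw [map_mul, map_inv, ht, mul_inv_cancel_right]
  match m, m' with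
  | 0, 0 => rfl
  | 1, 1 => rfl
  | 0, 1 => exact (key ⟨h, h'⟩).elim
  | 1, 0 => exact (key ⟨h', h⟩).elim

/-! ### Gallery points in the quotient -/

variable {n : ℕ} {w : Fin n → Fin N}

theorem BottSamelsonProd.op_smul_apply (t : Fin n → maxTorus N) (x : BottSamelsonProd w)
    (j : Fin n) : (MulOpposite.op t • x) j =
      (torusIncl (w j) ((Fin.cons 1 t : Fin (n + 1) → maxTorus N) j.castSucc))⁻¹ * x j *
        torusIncl (w j) (t j) := rfl

theorem BottSamelson.mk_eq_mk_iff {x y : BottSamelsonProd w} :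
    BottSamelson.mk w x = BottSamelson.mk w y ↔
      ∃ t : Fin n → maxTorus N, MulOpposite.op t • y = x := by
  refine Quotient.eq.trans ?_
  constructor
  · rintro ⟨t, ht⟩
    exact ⟨t.unop, ht⟩
  · rintro ⟨t, ht⟩
    exact ⟨MulOpposite.op t, ht⟩

/-- The factors can be matched one at a time: whatever `t_{j-1}` has been chosen, the hypothesis
supplies a `t_j`. -/
theorem exists_op_smul_eq {x y : BottSamelsonProd w}
    (h : ∀ j, ∀ s : maxTorus N, ∃ t : maxTorus N,
      (torusIncl (w j) s)⁻¹ * y j * torusIncl (w j) t = x j) :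
    ∃ t : Fin n → maxTorus N, MulOpposite.op t • y = x := by
  choose F hF using h
  -- `u 0 = 1` is the missing left factor of the first coordinate; the default beyond `n` is never
  -- reached.
  let u : ℕ → maxTorus N := fun m =>
    Nat.rec 1 (fun j s => if hj : j < n then F ⟨j, hj⟩ s else 1) m
  refine ⟨fun j => u (j + 1), ?_⟩
  funext j
  rw [BottSamelsonProd.op_smul_apply]
  have h1 : (Fin.cons 1 (fun j : Fin n => u (j + 1)) : Fin (n + 1) → maxTorus N) =
      fun j : Fin (n + 1) => u j := by
    funext m
    refine Fin.cases rfl (fun _ => rfl) m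
  have h2 : u (j + 1) = F j (u j) := dif_pos j.2
  rw [h1]
  simp only [Fin.val_castSucc, h2]
  exact hF j (u j)

theorem BottSamelson.mk_eq_galleryPoint {x : BottSamelsonProd w} {γ : Gallery n}
    (hx : ∀ j, IsLiftOf (w j) (γ j) (x j)) : BottSamelson.mk w x = galleryPoint w γ := by
  refine BottSamelson.mk_eq_mk_iff.2 (exists_op_smul_eq fun j s => ?_)
  obtain ⟨t, ht⟩ := (hx j).torusIncl_mul s
  exact ⟨t, by rw [mul_assoc, ← ht, inv_mul_cancel_left]⟩

theorem smul_galleryPoint (g : maxTorus N × Circle) (γ : Gallery n) :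
    g • galleryPoint w γ = galleryPoint w γ := by
  refine BottSamelson.mk_eq_galleryPoint (x := torusAct w g _) fun j => ?_
  have h := (isLiftOf_simpleLift_pow (w j) (γ j)).rotate g.2
  unfold torusAct
  split_ifs
  · exact h.torusIncl_mul g.1
  · exact h

/-- The action of `T ^ n` multiplies each coordinate by torus elements on both sides, so the coset
`ṡ^m T` of each coordinate is an invariant of the class. -/
theorem galleryPoint_injective : Function.Injective (galleryPoint w) := by
  intro γ γ' h
  obtain ⟨t, ht⟩ := BottSamelson.mk_eq_mk_iff.1 h
  funext j
  have hj : torusIncl (w j) ((Fin.cons 1 t : Fin (n + 1) → maxTorus N) j.castSucc)⁻¹ *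
      simpleLift (w j) ^ (γ' j : ℕ) * torusIncl (w j) (t j) = simpleLift (w j) ^ (γ j : ℕ) :=
    congrFun ht j
  refine (isLiftOf_simpleLift_pow (w j) (γ j)).unique ?_
  rw [← hj]
  obtain ⟨u, hu⟩ := (isLiftOf_simpleLift_pow (w j) (γ' j)).torusIncl_mul
    ((Fin.cons 1 t : Fin (n + 1) → maxTorus N) j.castSucc)⁻¹
  exact ⟨u * t j, by rw [hu, map_mul, mul_assoc]⟩

/-! ### Fixed points are gallery points -/

theorem exists_torus_chain {x : BottSamelsonProd w}
    (hx : BottSamelson.mk w x ∈ MulAction.fixedPoints (maxTorus N × Circle) (BottSamelson w))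
    (s : maxTorus N) :
    ∃ v : ℕ → maxTorus N, v 0 = s ∧
      ∀ j : Fin n, torusIncl (w j) (v j) * x j = x j * torusIncl (w j) (v (j + 1)) := by
  obtain ⟨t, ht⟩ := BottSamelson.mk_eq_mk_iff.1
    (show BottSamelson.mk w (torusAct w (s, 1) x) = BottSamelson.mk w x from hx (s, 1))
  -- The chain is `t` shifted by one, with `s` in front: the first coordinate has no left factor
  -- from `T ^ n`, but is multiplied by `s` under the action.
  refine ⟨fun m => Nat.casesOn m s fun j => if hj : j < n then t ⟨j, hj⟩ else 1, rfl, ?_⟩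
  intro j
  have hj := congrFun ht j
  rw [BottSamelsonProd.op_smul_apply] at hj
  obtain ⟨j, hjn⟩ := j
  cases j with
  | zero =>
    change (torusIncl _ ((Fin.cons 1 t : Fin (n + 1) → maxTorus N) 0))⁻¹ * _ * _ =
      torusIncl _ s * rotate _ 1 _ at hj
    rw [rotate_one, Fin.cons_zero, map_one, inv_one, one_mul] at hj
    simpa [hjn] using hj.symm
  | succ j =>
    have hj' : j < n := by omega
    change (torusIncl _ (t ⟨j, hj'⟩))⁻¹ * _ * _ = rotate _ 1 _ at hj
    rw [rotate_one, mul_assoc, inv_mul_eq_iff_eq_mul] at hj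
    simpa [hjn, hj'] using hj.symm

theorem exists_isLiftOf_of_mem_fixedPoints {x : BottSamelsonProd w}
    (hx : BottSamelson.mk w x ∈ MulAction.fixedPoints (maxTorus N × Circle) (BottSamelson w))
    (j : Fin n) : ∃ m, IsLiftOf (w j) m (x j) := by
  have step : ∀ j : Fin n, (∀ s : maxTorus N, ∃ v : ℕ → maxTorus N, v j = s ∧
      ∀ l : Fin n, torusIncl (w l) (v l) * x l = x l * torusIncl (w l) (v (l + 1))) →
      ∃ m, IsLiftOf (w j) m (x j) := fun j h =>
    exists_isLiftOf_of_normalizes _ fun s => by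
      obtain ⟨v, rfl, hv⟩ := h s
      exact ⟨_, hv j⟩
  -- The induction claim is that every element of `T` occurs at position `j` of some chain, which is
  -- what `step` needs for `x j` to normalize `T`.
  have chain : ∀ j : ℕ, j < n → ∀ s : maxTorus N, ∃ v : ℕ → maxTorus N, v j = s ∧
      ∀ l : Fin n, torusIncl (w l) (v l) * x l = x l * torusIncl (w l) (v (l + 1)) := by
    intro j
    induction j with
    | zero => exact fun _ => exists_torus_chain hx
    | succ j ih =>
      intro hj s
      have ih' := ih (by omega)
      obtain ⟨m, hm⟩ := step ⟨j, by omega⟩ ih'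
      obtain ⟨u, hu⟩ := hm.exists_torusIncl_mul_eq s
      obtain ⟨v, rfl, hv⟩ := ih' u
      -- With `u x_j = x_j s` and `v_j = u`, cancelling `x_j` forces `v_{j+1} = s`.
      exact ⟨v, torusIncl_injective _ (mul_left_cancel ((hv ⟨j, by omega⟩).symm.trans hu)), hv⟩
  exact step j (chain j j.2)

theorem bijOn_galleryPoint (w : Fin n → Fin N) :
    Set.BijOn (galleryPoint w) Set.univ
      (MulAction.fixedPoints (maxTorus N × Circle) (BottSamelson w)) := by
  refine ⟨fun γ _ g => smul_galleryPoint g γ, galleryPoint_injective.injOn, fun y hy => ?_⟩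
  obtain ⟨x, rfl⟩ := Quotient.exists_rep y
  choose γ hγ using exists_isLiftOf_of_mem_fixedPoints hy
  exact ⟨γ, Set.mem_univ _, (BottSamelson.mk_eq_galleryPoint hγ).symm⟩

end BottSamelsonFixedPoints

theorem mainTheorem8 (N : ℕ) [Fact (2 ≤ N)] (n : ℕ) (w : Fin n → Fin N) :
    Set.BijOn (galleryPoint w) Set.univ
        (MulAction.fixedPoints (maxTorus N × Circle) (BottSamelson w)) ∧
      (MulAction.fixedPoints (maxTorus N × Circle) (BottSamelson w)).ncard = 2 ^ n ∧
      (IsReducedWord w →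
        (MulAction.fixedPoints (maxTorus N × Circle) (BottSamelson w)).ncard =
          2 ^ weylLength (wordProd w)) := by
  have hbij := bijOn_galleryPoint w
  have hcard : (MulAction.fixedPoints (maxTorus N × Circle) (BottSamelson w)).ncard = 2 ^ n := by
    rw [← hbij.image_eq, hbij.injOn.ncard_image, Set.ncard_univ]
    simp [Gallery]
  refine ⟨hbij, hcard, fun hw => ?_⟩
  rw [hcard, show weylLength (wordProd w) = n from hw]
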